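/- A left semi-brace is a set $B$ with two operations $+$ and $\circ$ such that $(B,+)$ is a left cancellative semigroup, $(B,\circ)$ is a group and $a\circ(b+c)=a\circ b+a\circ(a^-+c)$ for all $a,b,c\in B$, where $a^-$ is the inverse of $a$ in $(B,\circ)$. Let $0$ be the identity of $(B,\circ)$, let $E$ be the set of idempotents of $(B,+)$ and let $G=B+0$, which is a group under $+$ (with identity $0$). Put $\lambda_a(b)=a\circ(a^-+b)$, $\rho_b(a)=(a^-+b)^-\circ b$ and $$a\cdot b=\lambda_a(a^-)+a\circ b+\lambda_b(b^-)\in G .$$ For $X,Y\subseteq B$ let $X\cdot Y$ be the subgroup of $(G,+)$ generated by the elements $x\cdot y$ with $x\in X$, $y\in Y$. An ideal of $B$ is a subsemigroup $I$ of $(B,+)$ such that $I$ is a normal subgroup of $(B,\circ)$, $I\cap G$ is a normal subgroup of $(G,+)$, $\rho_b(n)\in I$ for all $b\in B$ and $n\in I\cap G$, and $\lambda_g(e)\in I$ for all $g\in G$ and $e\in I\cap E$. In that case $B/I$ denotes the quotient left semi-brace of $B$ by the congruence $a\sim b\iff a\circ b^-\in I$. The socle $\mathrm{Soc}(B)=\{a\in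 B : \rho_a=\rho_0,\ \lambda_a=\lambda_0\}$ is an ideal of $B$. The socle series is defined by $\mathrm{Soc}_0(B)=\{0\}$ and, for $k\ge 1$, $\mathrm{Soc}_k(B)$ is the ideal of $B$ containing $\mathrm{Soc}_{k-1}(B)$ with $\mathrm{Soc}_k(B)/\mathrm{Soc}_{k-1}(B)=\mathrm{Soc}(B/\mathrm{Soc}_{k-1}(B))$; in particular $\mathrm{Soc}_1(B)=\mathrm{Soc}(B)$. With $\zeta_k(B)$ the $k$-th term of the upper central series of $(B,\circ)$, put $$\mathrm{Ann}_k(B)=\mathrm{Soc}_k(B)\cap\zeta_k(B)+E\cap\zeta_k(B).$$ $B$ is nilpotent if $\mathrm{Ann}_n(B)=B$ for some positive integer $n$. Let $B^{(1)}=B^1=B$, $B^{(n+1)}=B^{(n)}\cdot B+E$ and $B^{n+1}=B\cdot B^{n}+E$ for $n\ge 1$. $B$ is right nilpotent if $B^{(n)}=E$ for some positive integer $n$, and left nilpotent if $B^{n}=E$ for some positive integer $n$. **Theorem.** Let $B$ be a nilpotent left semi-brace such that $E$ is an ideal of $B$. Then $B$ is right nilpotent. Moreover, if $(G,+)$ is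 a finite nilpotent group, then $B$ is left nilpotent. -/

import Mathlib

open scoped Pointwise

universe u

/-- A left semi-brace: `(B, +)` is a left cancellative semigroup, `(B, *)` is a group (the product
`*` is the operation `∘` of semi-braces) and `a ∘ (b + c) = a ∘ b + a ∘ (a⁻ + c)`.
The identity of `(B, ∘)`, usually written `0`, is written `1` here. -/
class LeftSemiBrace (B : Type u) extends Group B, AddLeftCancelSemigroup B where
  mul_add' : ∀ a b c : B, a * (b + c) = a * b + a * (a⁻¹ + c)

namespace LeftSemiBrace

section Basic

variable {B : Type u} [LeftSemiBrace B]

/-- `λ_a(b) = a ∘ (a⁻ + b)`. -/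
def lam (a b : B) : B := a * (a⁻¹ + b)

/-- `ρ_b(a) = (a⁻ + b)⁻ ∘ b`. -/
def rho (b a : B) : B := (a⁻¹ + b)⁻¹ * b

/-- `λ_a(a⁻)`; on the additive group `G` it is the additive inverse. -/
def opp (a : B) : B := lam a a⁻¹

/-- `a · b = λ_a(a⁻) + a ∘ b + λ_b(b⁻)`. -/
def dot (a b : B) : B := opp a + a * b + opp b

variable (B) in
/-- The set `E` of idempotents of `(B, +)`. -/
def E : Set B := {e | e + e = e}

variable (B) in
/-- `G = B + 0` (recall that `1 : B` is the common zero). -/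
def G : Set B := Set.range fun x : B => x + 1

theorem one_add' (b : B) : 1 + b = b := by
  have h := mul_add' (1 : B) 1 b
  simp only [one_mul, inv_one] at h
  exact (add_left_cancel h).symm

theorem mul_eq_add_lam (a b : B) : a * b = a + lam a b := by
  have h := mul_add' a 1 b
  rwa [one_add', mul_one] at h

theorem mul_add_lam (a b c : B) : a * (b + c) = a * b + lam a c := mul_add' a b c

theorem lam_add (a b c : B) : lam a (b + c) = lam a b + lam a c := by
  unfold lam
  rw [← add_assoc, mul_add']

theorem lam_mul (a b c : B) : lam (a * b) c = lam a (lam b c) := by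
  apply add_left_cancel (a := a * b)
  rw [← mul_eq_add_lam, mul_assoc, mul_eq_add_lam b c, mul_add_lam]

theorem lam_one_left (b : B) : lam 1 b = b := by
  simp [lam, one_add']

theorem lam_inv_lam (a b : B) : lam a⁻¹ (lam a b) = b := by
  rw [← lam_mul, inv_mul_cancel, lam_one_left]

theorem lam_lam_inv (a b : B) : lam a (lam a⁻¹ b) = b := by
  rw [← lam_mul, mul_inv_cancel, lam_one_left]

theorem add_eq_mul_lam (a b : B) : a + b = a * lam a⁻¹ b := by
  rw [mul_eq_add_lam, lam_lam_inv]

theorem add_opp (a : B) : a + opp a = 1 := by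
  rw [opp, ← mul_eq_add_lam, mul_inv_cancel]

theorem add_lam_one (a : B) : a + lam a 1 = a := by
  rw [← mul_eq_add_lam, mul_one]

theorem mem_G {b : B} : b ∈ G B ↔ b + 1 = b := by
  constructor
  · rintro ⟨x, rfl⟩
    change x + 1 + 1 = x + 1
    rw [add_assoc, one_add']
  · intro h
    exact ⟨b, h⟩

theorem one_mem_G : (1 : B) ∈ G B := mem_G.2 (one_add' 1)

theorem add_mem_G (a : B) {b : B} (hb : b ∈ G B) : a + b ∈ G B := by
  rw [mem_G] at *
  rw [add_assoc, hb]

theorem opp_mem_G (a : B) : opp a ∈ G B := by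
  rw [mem_G]
  apply add_left_cancel (a := a)
  rw [← add_assoc, add_opp, one_add']

theorem opp_add {a : B} (ha : a ∈ G B) : opp a + a = 1 := by
  apply add_left_cancel (a := a)
  rw [← add_assoc, add_opp, one_add', mem_G.1 ha]

instance : Add (G B) := ⟨fun a b => ⟨a.1 + b.1, add_mem_G _ b.2⟩⟩

instance : Zero (G B) := ⟨⟨1, one_mem_G⟩⟩

instance : Neg (G B) := ⟨fun a => ⟨opp a.1, opp_mem_G _⟩⟩

/-- `(G, +)` is a group. -/
instance : AddGroup (G B) where
  add_assoc _ _ _ := Subtype.ext (add_assoc _ _ _)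
  zero_add _ := Subtype.ext (one_add' _)
  add_zero a := Subtype.ext (mem_G.1 a.2)
  nsmul := nsmulRec
  zsmul := zsmulRec
  neg_add_cancel a := Subtype.ext (opp_add a.2)

theorem coe_add_G (a b : G B) : ((a + b : G B) : B) = a + b := rfl
theorem coe_neg_G (a : G B) : ((-a : G B) : B) = opp (a : B) := rfl
theorem coe_zero_G : ((0 : G B) : B) = 1 := rfl

theorem dot_mem_G (a b : B) : dot a b ∈ G B := add_mem_G _ (opp_mem_G b)

/-- `X · Y`: the subgroup of `(G, +)` generated by the elements `x · y`, `x ∈ X`, `y ∈ Y`. -/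
def dotSubgroup (X Y : Set B) : AddSubgroup (G B) :=
  AddSubgroup.closure {g | ∃ x ∈ X, ∃ y ∈ Y, g = ⟨dot x y, dot_mem_G x y⟩}

/-- `X · Y + E`, as a subset of `B`. -/
def dotAddE (X Y : Set B) : Set B :=
  (Subtype.val '' (dotSubgroup X Y : Set (G B))) + E B

variable (B) in
/-- The right series, indexed from `0`: `rightSeries B n` is `B^(n+1)`, where `B^(1) = B` and
`B^(n+1) = B^(n) · B + E`. -/
def rightSeries : ℕ → Set B
  | 0 => Set.univ
  | n + 1 => dotAddE (rightSeries n) Set.univ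

variable (B) in
/-- The left series, indexed from `0`: `leftSeries B n` is `B^(n+1)`, where `B^1 = B` and
`B^(n+1) = B · B^n + E`. -/
def leftSeries : ℕ → Set B
  | 0 => Set.univ
  | n + 1 => dotAddE Set.univ (leftSeries n)

variable (B) in
/-- `B^(n) = E` for some positive integer `n`. -/
def IsRightNilpotent : Prop := ∃ n, rightSeries B n = E B

variable (B) in
/-- `B^n = E` for some positive integer `n`. -/
def IsLeftNilpotent : Prop := ∃ n, leftSeries B n = E B

/-- Ideals of a left semi-brace. -/
structure IsIdeal (I : Set B) : Prop where
  /-- `I` is a subsemigroup of `(B, +)`. -/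
  add_mem : ∀ x ∈ I, ∀ y ∈ I, x + y ∈ I
  /-- `I` is a normal subgroup of `(B, ∘)`. -/
  normal_mul : ∃ N : Subgroup B, N.Normal ∧ (N : Set B) = I
  /-- `I ∩ G` is a normal subgroup of `(G, +)`. -/
  normal_add : ∃ N : AddSubgroup (G B), N.Normal ∧ (N : Set (G B)) = {g : G B | (g : B) ∈ I}
  rho_mem : ∀ b : B, ∀ n ∈ I ∩ G B, rho b n ∈ I
  lam_mem : ∀ g ∈ G B, ∀ e ∈ I ∩ E B, lam g e ∈ I

variable (B) in
/-- The socle of `B`. -/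
def socle : Set B := {a | rho a = rho (1 : B) ∧ lam a = lam (1 : B)}

/-! ### Quotients by ideals -/

theorem mem_G_iff_lam {a : B} : a ∈ G B ↔ lam a 1 = 1 := by
  rw [mem_G]
  constructor
  · intro h
    apply add_left_cancel (a := a)
    rw [add_lam_one, h]
  · intro h
    have := add_lam_one a
    rwa [h] at this

theorem mul_mem_G {a b : B} (ha : a ∈ G B) (hb : b ∈ G B) : a * b ∈ G B := by
  rw [mem_G_iff_lam] at *
  rw [lam_mul, hb, ha]

theorem inv_mem_G {a : B} (ha : a ∈ G B) : a⁻¹ ∈ G B := by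
  rw [mem_G_iff_lam] at *
  conv_lhs => rw [← ha]
  exact lam_inv_lam a 1

theorem add_one_mem_G (a : B) : a + 1 ∈ G B := ⟨a, rfl⟩

theorem rho_mem_G (b a : B) : rho b a ∈ G B := by
  rw [mem_G_iff_lam, rho, lam_mul]
  have h : lam b 1 = lam (a⁻¹ + b) 1 := by
    apply add_left_cancel (a := a⁻¹ + b)
    rw [add_lam_one, add_assoc, add_lam_one]
  rw [h, lam_inv_lam]

theorem lam_mem_E (b : B) {e : B} (he : e ∈ E B) : lam b e ∈ E B := by
  change lam b e + lam b e = lam b e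
  rw [← lam_add, show e + e = e from he]

theorem one_mem_E : (1 : B) ∈ E B := one_add' 1

theorem E_add {e : B} (he : e ∈ E B) (b : B) : e + b = b := by
  apply add_left_cancel (a := e)
  rw [← add_assoc, show e + e = e from he]

namespace IsIdeal

variable {I : Set B}

theorem one_mem (h : IsIdeal I) : (1 : B) ∈ I := by
  obtain ⟨N, -, rfl⟩ := h.normal_mul
  exact N.one_mem

theorem mul_mem (h : IsIdeal I) {x y : B} (hx : x ∈ I) (hy : y ∈ I) : x * y ∈ I := by
  obtain ⟨N, -, rfl⟩ := h.normal_mul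
  exact N.mul_mem hx hy

theorem inv_mem (h : IsIdeal I) {x : B} (hx : x ∈ I) : x⁻¹ ∈ I := by
  obtain ⟨N, -, rfl⟩ := h.normal_mul
  exact N.inv_mem hx

theorem conj_mem (h : IsIdeal I) {x : B} (hx : x ∈ I) (b : B) : b * x * b⁻¹ ∈ I := by
  obtain ⟨N, hN, rfl⟩ := h.normal_mul
  exact hN.conj_mem x hx b

theorem add_one_mem (h : IsIdeal I) {x : B} (hx : x ∈ I) : x + 1 ∈ I := h.add_mem _ hx _ h.one_mem

theorem opp_mem (h : IsIdeal I) {x : B} (hx : x ∈ I) : opp x ∈ I := by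
  obtain ⟨N, -, hN⟩ := h.normal_add
  have h1 : (⟨x + 1, add_one_mem_G x⟩ : G B) ∈ N := by
    change _ ∈ (N : Set (G B))
    rw [hN]
    exact h.add_one_mem hx
  have h2 : opp (x + 1) ∈ I := by
    have : -(⟨x + 1, add_one_mem_G x⟩ : G B) ∈ (N : Set (G B)) := N.neg_mem h1
    rw [hN] at this
    exact this
  have h3 : opp (x + 1) = opp x := by
    apply add_left_cancel (a := x)
    rw [add_opp]
    have := add_opp (x + 1)
    rwa [add_assoc, one_add'] at this
  rwa [h3] at h2

theorem add_conj_mem (h : IsIdeal I) {x : B} (hx : x ∈ I) (hxG : x ∈ G B) {g : B} (hg : g ∈ G B) :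
    opp g + x + g ∈ I := by
  obtain ⟨N, hn, hN⟩ := h.normal_add
  have h1 : (⟨x, hxG⟩ : G B) ∈ N := by
    change _ ∈ (N : Set (G B))
    rw [hN]
    exact hx
  have : -(⟨g, hg⟩ : G B) + ⟨x, hxG⟩ + ⟨g, hg⟩ ∈ (N : Set (G B)) := by
    simpa using hn.conj_mem _ h1 (-(⟨g, hg⟩ : G B))
  rw [hN] at this
  exact this

theorem lam_mem_of_mem (h : IsIdeal I) {g x : B} (hg : g ∈ G B) (hx : x ∈ I) : lam g x ∈ I := by
  have key : lam g (x + 1) ∈ I := by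
    have hxG : (x + 1)⁻¹ ∈ G B := inv_mem_G (add_one_mem_G x)
    have h1 := h.inv_mem (h.rho_mem g⁻¹ (x + 1)⁻¹ ⟨h.inv_mem (h.add_one_mem hx), hxG⟩)
    have h2 : (rho g⁻¹ (x + 1)⁻¹)⁻¹ = g * (x + 1) + opp g := by
      simp [rho, opp, mul_add_lam]
    rw [h2] at h1
    have h3 := h.add_conj_mem h1 (add_mem_G _ (opp_mem_G g)) hg
    have h4 : opp g + (g * (x + 1) + opp g) + g = lam g (x + 1) := by
      apply add_left_cancel (a := g)
      rw [← mul_eq_add_lam, ← add_assoc, ← add_assoc, add_opp, one_add', add_assoc,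
        opp_add hg, mem_G.1 (mul_mem_G hg (add_one_mem_G x))]
    rwa [h4] at h3
  have hE : lam x 1 ∈ E B := lam_mem_E x one_mem_E
  have hxE : opp x + x = lam x 1 := by
    apply add_left_cancel (a := x)
    rw [← add_assoc, add_opp, one_add', add_lam_one]
  have h5 : lam g (lam x 1) ∈ I :=
    h.lam_mem g hg _ ⟨hxE ▸ h.add_mem _ (h.opp_mem hx) _ hx, hE⟩
  have h6 : lam g x = lam g (x + 1) + lam g (lam x 1) := by
    rw [← lam_add, add_assoc, one_add', add_lam_one]
  rw [h6]
  exact h.add_mem _ key _ h5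

theorem lam_rel (h : IsIdeal I) (b : B) {x y : B} (hxy : x * y⁻¹ ∈ I) : lam b x * (lam b y)⁻¹ ∈ I := by
  have h1 : y⁻¹ * x ∈ I := by
    have := h.conj_mem hxy y⁻¹
    simpa [mul_assoc] using this
  have h2 : lam b x = lam b y * lam (rho y b) (y⁻¹ * x) := by
    have e1 : rho y b = (lam b y)⁻¹ * (b * y) := by simp [rho, lam, mul_assoc]
    have e2 : x = y + lam y (y⁻¹ * x) := by rw [← mul_eq_add_lam, mul_inv_cancel_left]
    rw [e1, lam_mul, mul_eq_add_lam (lam b y), lam_lam_inv, lam_mul, ← lam_add, ← e2]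
  rw [h2]
  exact h.conj_mem (h.lam_mem_of_mem (rho_mem_G y b) h1) _

theorem add_left_rel (h : IsIdeal I) {i : B} (hi : i ∈ I) (y : B) : (i + y) * y⁻¹ ∈ I := by
  have h1 := h.rho_mem y (i + 1)⁻¹ ⟨h.inv_mem (h.add_one_mem hi), inv_mem_G (add_one_mem_G i)⟩
  have h2 : (rho y (i + 1)⁻¹)⁻¹ = y⁻¹ * (i + y) := by
    simp [rho, add_assoc, one_add']
  have h3 := h.conj_mem (h.inv_mem h1) y
  rwa [h2, mul_inv_cancel_left] at h3

theorem rel_trans (h : IsIdeal I) {x y z : B} (hxy : x * y⁻¹ ∈ I) (hyz : y * z⁻¹ ∈ I) : x * z⁻¹ ∈ I := by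
  simpa [mul_assoc] using h.mul_mem hxy hyz

theorem rel_mul (h : IsIdeal I) {x x' y y' : B} (hx : x * x'⁻¹ ∈ I) (hy : y * y'⁻¹ ∈ I) :
    x * y * (x' * y')⁻¹ ∈ I := by
  have h1 := h.mul_mem (h.conj_mem hy x) hx
  simpa [mul_assoc] using h1

theorem rel_add (h : IsIdeal I) {x x' y y' : B} (hx : x * x'⁻¹ ∈ I) (hy : y * y'⁻¹ ∈ I) :
    (x + y) * (x' + y')⁻¹ ∈ I := by
  rw [add_eq_mul_lam x y, add_eq_mul_lam x' y']
  refine h.rel_mul hx (h.rel_trans (h.lam_rel _ hy) ?_)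
  have hi : x⁻¹ * x' ∈ I := by
    have := h.conj_mem (h.inv_mem hx) x⁻¹
    simpa [mul_assoc] using this
  have e : lam x⁻¹ y' = lam (x⁻¹ * x') (lam x'⁻¹ y') := by
    rw [← lam_mul, mul_inv_cancel_right]
  rw [e]
  generalize lam x'⁻¹ y' = w
  generalize x⁻¹ * x' = i at *
  have h1 : i * 1⁻¹ ∈ I := by simpa using hi
  have h2 := h.rel_mul h1 (h.add_left_rel (h.inv_mem hi) w)
  simpa [lam] using h2

/-- The congruence of `(B, ∘)` defined by an ideal: `a ∼ b` if and only if `a ∘ b⁻ ∈ I`. -/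
def con (h : IsIdeal I) : Con B where
  r a b := a * b⁻¹ ∈ I
  iseqv :=
    { refl := fun a => by simpa using h.one_mem
      symm := fun {a b} hab => by simpa using h.inv_mem hab
      trans := fun hab hbc => h.rel_trans hab hbc }
  mul' := fun hx hy => h.rel_mul hx hy

/-- The same relation as a congruence of `(B, +)`. -/
def addCon (h : IsIdeal I) : AddCon B where
  r a b := a * b⁻¹ ∈ I
  iseqv := h.con.iseqv
  add' := fun hx hy => h.rel_add hx hy

/-- The quotient left semi-brace `B / I`, with the induced operations. -/
def Quo (h : IsIdeal I) : Type u := h.con.Quotient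

/-- The projection `B → B / I`. -/
def proj (h : IsIdeal I) (b : B) : h.Quo := (b : h.con.Quotient)

instance (h : IsIdeal I) : Group h.Quo := inferInstanceAs (Group h.con.Quotient)

instance (h : IsIdeal I) : AddSemigroup h.Quo := inferInstanceAs (AddSemigroup h.addCon.Quotient)

theorem proj_eq (h : IsIdeal I) {a b : B} : h.proj a = h.proj b ↔ a * b⁻¹ ∈ I := Con.eq h.con

theorem proj_surjective (h : IsIdeal I) : Function.Surjective h.proj := fun x => Quotient.exists_rep x

theorem proj_mul (h : IsIdeal I) (a b : B) : h.proj (a * b) = h.proj a * h.proj b := rfl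

theorem proj_inv (h : IsIdeal I) (a : B) : h.proj a⁻¹ = (h.proj a)⁻¹ := rfl

theorem proj_one (h : IsIdeal I) : h.proj 1 = 1 := rfl

theorem proj_add (h : IsIdeal I) (a b : B) : h.proj (a + b) = h.proj a + h.proj b := rfl

instance (h : IsIdeal I) : LeftSemiBrace h.Quo where
  toGroup := inferInstance
  toAddSemigroup := inferInstance
  add_left_cancel := by
    intro x y z hyz
    obtain ⟨x, rfl⟩ := h.proj_surjective x
    obtain ⟨y, rfl⟩ := h.proj_surjective y
    obtain ⟨z, rfl⟩ := h.proj_surjective z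
    change h.proj x + h.proj y = h.proj x + h.proj z at hyz
    rw [← h.proj_add, ← h.proj_add, add_eq_mul_lam, add_eq_mul_lam, h.proj_mul, h.proj_mul] at hyz
    have h1 := h.lam_rel x (h.proj_eq.1 (mul_left_cancel hyz))
    rw [lam_lam_inv, lam_lam_inv] at h1
    exact h.proj_eq.2 h1
  mul_add' := by
    intro x y z
    obtain ⟨x, rfl⟩ := h.proj_surjective x
    obtain ⟨y, rfl⟩ := h.proj_surjective y
    obtain ⟨z, rfl⟩ := h.proj_surjective z
    exact congrArg h.proj (mul_add' x y z)

theorem proj_lam (h : IsIdeal I) (a b : B) : h.proj (lam a b) = lam (h.proj a) (h.proj b) := rfl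

theorem proj_rho (h : IsIdeal I) (a b : B) : h.proj (rho a b) = rho (h.proj a) (h.proj b) := rfl

theorem proj_mem_G (h : IsIdeal I) {a : B} (ha : a ∈ G B) : h.proj a ∈ G h.Quo := by
  rw [mem_G] at *
  rw [← h.proj_one, ← h.proj_add, ha]

theorem proj_mem_E (h : IsIdeal I) {a : B} (ha : a ∈ E B) : h.proj a ∈ E h.Quo :=
  congrArg h.proj (show a + a = a from ha)

/-- The preimage in `B` of an ideal of `B / I` is an ideal of `B`. -/
theorem preimage (h : IsIdeal I) {J : Set h.Quo} (hJ : IsIdeal J) : IsIdeal (h.proj ⁻¹' J) where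
  add_mem x hx y hy := hJ.add_mem _ hx _ hy
  normal_mul := by
    refine ⟨{ carrier := h.proj ⁻¹' J
              mul_mem' := fun ha hb => hJ.mul_mem ha hb
              one_mem' := hJ.one_mem
              inv_mem' := fun ha => hJ.inv_mem ha }, ⟨fun n hn g => ?_⟩, rfl⟩
    exact hJ.conj_mem (x := h.proj n) hn (h.proj g)
  normal_add := by
    obtain ⟨N, hn, hN⟩ := hJ.normal_add
    let f : G B →+ G h.Quo :=
      { toFun := fun g => ⟨h.proj g, h.proj_mem_G g.2⟩
        map_zero' := rfl
        map_add' := fun _ _ => rfl }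
    refine ⟨N.comap f, hn.comap f, ?_⟩
    ext g
    change f g ∈ (N : Set (G h.Quo)) ↔ _
    rw [hN]
    rfl
  rho_mem b n hb := hJ.rho_mem (h.proj b) (h.proj n) ⟨hb.1, h.proj_mem_G hb.2⟩
  lam_mem g hg e he := hJ.lam_mem (h.proj g) (h.proj_mem_G hg) (h.proj e) ⟨he.1, h.proj_mem_E he.2⟩

end IsIdeal

/-! ### The socle is an ideal -/

theorem mem_socle {a : B} :
    a ∈ socle B ↔ (∀ b, a * b = a + b) ∧ ∀ c, c + a = a + c + 1 := by
  have hl : lam a = lam (1 : B) ↔ ∀ b, a * b = a + b := by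
    rw [funext_iff]
    refine forall_congr' fun b => ?_
    rw [mul_eq_add_lam, add_right_inj, lam_one_left]
  have hr : rho a = rho (1 : B) ↔ ∀ c, c + a = a * (c + 1) := by
    rw [funext_iff]
    constructor
    · intro h c
      have := h c⁻¹
      simp only [rho, inv_inv, mul_one] at this
      rw [inv_mul_eq_iff_eq_mul, eq_mul_inv_iff_mul_eq] at this
      exact this.symm
    · intro h b
      simp only [rho, mul_one]
      rw [h, mul_inv_rev, inv_mul_cancel_right]
  rw [socle, Set.mem_ofPred_eq, hl, hr, and_comm]
  refine and_congr_right fun h => forall_congr' fun c => ?_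
  rw [h, add_assoc]

theorem socle_mem_G {a : B} (ha : a ∈ socle B) : a ∈ G B := by
  have := (mem_socle.1 ha).2 1
  rw [one_add', add_assoc, one_add'] at this
  exact mem_G.2 this.symm

theorem socle_mul_eq {a : B} (ha : a ∈ socle B) (b : B) : a * b = a + b := (mem_socle.1 ha).1 b

theorem socle_comm {a : B} (ha : a ∈ socle B) (c : B) : c + a = a + c + 1 := (mem_socle.1 ha).2 c

theorem socle_lam {a : B} (ha : a ∈ socle B) (b : B) : lam a b = b := by
  rw [ha.2, lam_one_left]

theorem one_mem_socle : (1 : B) ∈ socle B := ⟨rfl, rfl⟩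

theorem socle_mul_mem {a b : B} (ha : a ∈ socle B) (hb : b ∈ socle B) : a * b ∈ socle B := by
  rw [mem_socle]
  refine ⟨fun c => ?_, fun c => ?_⟩
  · rw [mul_assoc, socle_mul_eq ha, socle_mul_eq hb, socle_mul_eq ha, add_assoc]
  · rw [socle_mul_eq ha, ← add_assoc, socle_comm ha, add_assoc (a + c) 1 b, one_add', add_assoc,
      socle_comm hb, ← add_assoc, ← add_assoc]

theorem socle_inv_mem {a : B} (ha : a ∈ socle B) : a⁻¹ ∈ socle B := by
  have hl : ∀ b, lam a⁻¹ b = b := fun b => by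
    conv_lhs => rw [← socle_lam ha b]
    exact lam_inv_lam a b
  have h1 : a + a⁻¹ = 1 := by rw [← socle_mul_eq ha, mul_inv_cancel]
  rw [mem_socle]
  refine ⟨fun b => by rw [mul_eq_add_lam, hl], fun c => ?_⟩
  apply add_left_cancel (a := a)
  have h2 : a + (c + a⁻¹) = c + 1 := by
    calc a + (c + a⁻¹) = a + c + 1 + a⁻¹ := by
          rw [add_assoc (a + c) 1, one_add', add_assoc]
      _ = c + 1 := by rw [← socle_comm ha, add_assoc, h1]
  rw [h2, ← add_assoc, ← add_assoc, h1, one_add']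

theorem socle_conj_mem {a : B} (ha : a ∈ socle B) (x : B) : x * a * x⁻¹ ∈ socle B := by
  have hy : x * a * x⁻¹ = x + lam x a + opp x := by
    rw [mul_assoc, socle_mul_eq ha, mul_add_lam, mul_eq_add_lam]
    rfl
  have hl : ∀ b, lam (x * a * x⁻¹) b = b := fun b => by
    rw [lam_mul, lam_mul, socle_lam ha, lam_lam_inv]
  -- `λ_x(a)` commutes with all elements up to the idempotent part
  have hc : ∀ c, c + lam x a + 1 = lam x a + c + 1 := fun c => by
    have h1 := congrArg (lam x) (socle_comm ha (lam x⁻¹ c))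
    rw [lam_add, lam_add, lam_add, lam_lam_inv] at h1
    rw [h1, add_assoc, E_add (lam_mem_E x one_mem_E)]
  have h1o : ∀ c : B, c + opp x = c + 1 + opp x := fun c => by rw [add_assoc, one_add']
  rw [mem_socle]
  refine ⟨fun b => by rw [mul_eq_add_lam, hl], fun c => ?_⟩
  have hyy : x * a * x⁻¹ = lam x a + 1 := by
    rw [hy, h1o, hc, ← h1o, add_assoc, add_opp]
  rw [hyy, ← add_assoc, hc, add_assoc (lam x a) 1 c, one_add']

/-- The socle is an ideal. -/
theorem socle_isIdeal : IsIdeal (socle B) where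
  add_mem x hx y hy := socle_mul_eq hx y ▸ socle_mul_mem hx hy
  normal_mul :=
    ⟨{ carrier := socle B
       mul_mem' := socle_mul_mem
       one_mem' := one_mem_socle
       inv_mem' := socle_inv_mem }, ⟨fun _ hn g => socle_conj_mem hn g⟩, rfl⟩
  normal_add := by
    refine ⟨{ carrier := {g : G B | (g : B) ∈ socle B}
              add_mem' := fun {a b} ha hb => ?_
              zero_mem' := one_mem_socle
              neg_mem' := fun {a} ha => ?_ }, ⟨fun n hn g => ?_⟩, rfl⟩
    · change (a : B) + b ∈ socle B
      rw [← socle_mul_eq ha]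
      exact socle_mul_mem ha hb
    · change opp (a : B) ∈ socle B
      rw [opp, socle_lam ha]
      exact socle_inv_mem ha
    · change (g : B) + n + opp (g : B) ∈ socle B
      have hn' : (n : B) ∈ socle B := hn
      rw [socle_comm hn', add_assoc _ 1, one_add', add_assoc, add_opp, mem_G.1 n.2]
      exact hn'
  rho_mem b n hn := by
    have h1 : rho b n = b⁻¹ * n * b := by
      rw [rho, ← socle_mul_eq (socle_inv_mem hn.1), mul_inv_rev, inv_inv]
    rw [h1]
    simpa using socle_conj_mem hn.1 b⁻¹
  lam_mem g hg e he := by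
    have h1 : e = 1 := by
      rw [← mem_G.1 (socle_mem_G he.1), E_add he.2]
    rw [h1, mem_G_iff_lam.1 hg]
    exact one_mem_socle

theorem zero_isIdeal : IsIdeal ({1} : Set B) where
  add_mem := by
    rintro x rfl y rfl
    exact one_add' 1
  normal_mul := ⟨⊥, inferInstance, by simp⟩
  normal_add := ⟨⊥, inferInstance, by
    ext g
    exact (Subtype.ext_iff : g = (0 : G B) ↔ _)⟩
  rho_mem := by
    rintro b n ⟨rfl, -⟩
    simp [rho, one_add']
  lam_mem := by
    rintro g hg e ⟨rfl, -⟩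
    exact mem_G_iff_lam.1 hg

/-! ### Socle series, annihilator series, nilpotency -/

variable (B) in
/-- The socle series, with the proof that its terms are ideals: `Soc_0(B) = 0`, and `Soc_{k+1}(B)`
is the ideal containing `Soc_k(B)` with `Soc_{k+1}(B) / Soc_k(B) = Soc(B / Soc_k(B))`, i.e. the
preimage of `Soc(B / Soc_k(B))` in `B`. -/
def socleSeriesAux : ℕ → {I : Set B // IsIdeal I}
  | 0 => ⟨{1}, zero_isIdeal⟩
  | k + 1 =>
    ⟨(socleSeriesAux k).2.proj ⁻¹' socle (socleSeriesAux k).2.Quo,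
      (socleSeriesAux k).2.preimage socle_isIdeal⟩

variable (B) in
/-- `Soc_k(B)`. -/
def socleSeries (k : ℕ) : Set B := (socleSeriesAux B k).1

theorem socleSeries_one : socleSeries B 1 = socle B := by
  ext a
  have key : ∀ x y : B, (zero_isIdeal (B := B)).proj x = (zero_isIdeal (B := B)).proj y ↔ x = y := by
    intro x y; rw [IsIdeal.proj_eq]; simp [mul_inv_eq_one]
  change (rho ((zero_isIdeal (B := B)).proj a) = rho 1 ∧
    lam ((zero_isIdeal (B := B)).proj a) = lam 1) ↔ (rho a = rho 1 ∧ lam a = lam 1)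
  simp only [funext_iff, ← IsIdeal.proj_one,
    (zero_isIdeal (B := B)).proj_surjective.forall, ← IsIdeal.proj_lam,
    ← IsIdeal.proj_rho, key]

variable (B) in
/-- `Ann_k(B) = Soc_k(B) ∩ ζ_k(B) + E ∩ ζ_k(B)`, where `ζ_k(B)` is the `k`-th centre of
`(B, ∘)`. -/
def annSeries (k : ℕ) : Set B :=
  (socleSeries B k ∩ (Subgroup.upperCentralSeries B k : Set B)) +
    (E B ∩ (Subgroup.upperCentralSeries B k : Set B))

variable (B) in
/-- `B` is nilpotent if `Ann_n(B) = B` for some positive integer `n`. -/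
def IsNilpotent : Prop := ∃ n : ℕ, 0 < n ∧ annSeries B n = Set.univ

end Basic

end LeftSemiBrace

/-!
Every element `x` of `B` is the sum of `x + 1 ∈ G` and of the idempotent `λ_x(1)`, and idempotents
are left neutral for `+`, so a subset of the form `X + E` is controlled by its part in `G`.

All terms of the socle series lie in `G`. Hence, if `Ann_n(B) = B`, comparing components in `G`
gives `G = Soc_n(B)` and `G ⊆ ζ_n(B)` (`IsNilpotent.exists_G_subset`), and both series start
inside `Soc_n(B) + E`.

*Right nilpotency.* One has `x · b = λ_x(b) - b` (`dot_eq`), and when `E` is an ideal this depends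
only on the component of `x` in `G` (`dot_add_E_left`). An element of `Soc_{k+1}(B)` acts trivially
modulo `Soc_k(B)`, so each step of the right series lowers the index of the socle by one.

*Left nilpotency.* If `s` lies in the socle of a semi-brace, then `b · s` is the commutator of `b`
and `s` in `(B, ∘)` (`dot_socle_eq_commutator`). Applied to `B / Soc_k(B)`, this shows that the
sets `Soc(B / Soc_k(B)) ∩ ζ_i(B / Soc_k(B))` descend in `i` under `b · _`
(`dot_mem_socleCenter`). Since `G ⊆ ζ_n(B)`, at most `n` steps of the left series lead from
`Soc_{k+1}(B) + E` into `Soc_k(B) + E`, and `n * n` steps suffice.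
-/

namespace LeftSemiBrace

section Nilpotency

variable {B : Type u} [LeftSemiBrace B]

/-! ### The product `a · b` and components in `G` -/

theorem opp_add_E (x : B) {e : B} (he : e ∈ E B) : opp (x + e) = opp x := by
  apply add_left_cancel (a := x)
  rw [add_opp]
  have h := add_opp (x + e)
  rwa [add_assoc, E_add he] at h

theorem opp_add_self (x : B) : opp x + x = lam x 1 := by
  apply add_left_cancel (a := x)
  rw [← add_assoc, add_opp, one_add', add_lam_one]

theorem add_add_one_add (x y : B) : x + 1 + y = x + y := by
  rw [add_assoc, one_add']

theorem dot_eq (a b : B) : dot a b = lam a b + opp b := by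
  rw [dot, mul_eq_add_lam, ← add_assoc, opp_add_self, add_assoc, E_add (lam_mem_E a one_mem_E)]

theorem dot_add_E_right (a s : B) {e : B} (he : e ∈ E B) : dot a (s + e) = dot a s := by
  rw [dot_eq, dot_eq, opp_add_E s he, lam_add, add_assoc, E_add (lam_mem_E a he)]

/-- When `E` is an ideal, `λ_e` for `e ∈ E` does not change components in `G`. -/
theorem lam_E_add_one (hE : IsIdeal (E B)) {e : B} (he : e ∈ E B) (b : B) :
    lam e b + 1 = b + 1 := by
  have h1 : lam e b = e * b := by rw [lam, E_add (hE.inv_mem he)]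
  have h2 : b⁻¹ * (e * b) ∈ E B := by simpa [mul_assoc] using hE.conj_mem he b⁻¹
  have h3 : e * b = b + lam b (b⁻¹ * (e * b)) := by rw [← mul_eq_add_lam, mul_inv_cancel_left]
  rw [h1, h3, add_assoc, E_add (lam_mem_E b h2)]

theorem dot_add_E_left (hE : IsIdeal (E B)) {g : B} (hg : g ∈ G B) {e : B} (he : e ∈ E B) (b : B) :
    dot (g + e) b = dot g b := by
  have h : lam (g + e) b + 1 = lam g b + 1 := by
    -- `g + e = g ∘ λ_g⁻¹(e)`, and `λ_g` fixes `1`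
    have h1 : ∀ y, lam g y + 1 = lam g (y + 1) := fun y => by rw [lam_add, mem_G_iff_lam.1 hg]
    rw [add_eq_mul_lam g e, lam_mul, h1, h1, lam_E_add_one hE (lam_mem_E _ he)]
  rw [dot_eq, dot_eq, ← add_add_one_add, h, add_add_one_add]

theorem E_subset_dotAddE (X Y : Set B) : E B ⊆ dotAddE X Y := fun e he =>
  ⟨1, ⟨0, zero_mem _, rfl⟩, e, he, one_add' e⟩

/-- To bound `X · Y + E` by `S + E` it suffices to bound the generators `x · y`. -/
theorem dotAddE_subset {X Y S : Set B} (h1 : (1 : B) ∈ S) (hadd : ∀ x ∈ S, ∀ y ∈ S, x + y ∈ S)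
    (hopp : ∀ x ∈ S, opp x ∈ S) (hdot : ∀ x ∈ X, ∀ y ∈ Y, dot x y ∈ S) :
    dotAddE X Y ⊆ S + E B := by
  let N : AddSubgroup (G B) :=
    { carrier := {g | (g : B) ∈ S}
      add_mem' := fun ha hb => hadd _ ha _ hb
      zero_mem' := h1
      neg_mem' := fun ha => hopp _ ha }
  have hN : dotSubgroup X Y ≤ N := by
    refine (AddSubgroup.closure_le N).2 ?_
    rintro _ ⟨x, hx, y, hy, rfl⟩
    exact hdot x hx y hy
  refine Set.add_subset_add_right ?_
  rintro _ ⟨g, hg, rfl⟩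
  exact hN hg

/-! ### The socle series and the nilpotency hypothesis -/

theorem socleSeries_isIdeal (k : ℕ) : IsIdeal (socleSeries B k) := (socleSeriesAux B k).2

theorem mem_socleSeries_succ {k : ℕ} {a : B} : a ∈ socleSeries B (k + 1) ↔
    (socleSeries_isIdeal (B := B) k).proj a ∈ socle (socleSeries_isIdeal (B := B) k).Quo :=
  Iff.rfl

theorem IsIdeal.proj_eq_one {I : Set B} (h : IsIdeal I) {a : B} : h.proj a = 1 ↔ a ∈ I := by
  rw [← h.proj_one, h.proj_eq, inv_one, mul_one]

theorem IsIdeal.proj_dot {I : Set B} (h : IsIdeal I) (a b : B) :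
    h.proj (dot a b) = dot (h.proj a) (h.proj b) := rfl

theorem socleSeries_subset_G (k : ℕ) : socleSeries B k ⊆ G B := by
  induction k with
  | zero =>
    rintro _ rfl
    exact one_mem_G
  | succ k ih =>
    intro a ha
    have h := socleSeries_isIdeal (B := B) k
    have h1 := mem_G.1 (socle_mem_G (mem_socleSeries_succ.1 ha))
    rw [← h.proj_one, ← h.proj_add, h.proj_eq] at h1
    -- `(a + 1) ∘ a⁻` lies in the subgroup `G`, and so does `a + 1`
    have h2 := inv_mem_G (mul_mem_G (inv_mem_G (add_one_mem_G a)) (ih h1))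
    simpa using h2

/-- In a nilpotent left semi-brace `G` is exhausted by both the socle series of `B` and the upper
central series of `(B, ∘)`. -/
theorem IsNilpotent.exists_G_subset (hB : IsNilpotent B) : ∃ n : ℕ,
    G B ⊆ socleSeries B n ∧ G B ⊆ (Subgroup.upperCentralSeries B n : Set B) := by
  obtain ⟨n, -, hn⟩ := hB
  have key : G B ⊆ socleSeries B n ∩ (Subgroup.upperCentralSeries B n : Set B) := by
    intro g hg
    obtain ⟨s, hs, e, he, rfl⟩ : g ∈ annSeries B n := hn ▸ Set.mem_univ g
    have h : s + e = s := by
      have h1 := mem_G.1 hg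
      rw [add_assoc, E_add he.1, mem_G.1 (socleSeries_subset_G n hs.1)] at h1
      exact h1.symm
    change s + e ∈ _
    rwa [h]
  exact ⟨n, fun g hg => (key hg).1, fun g hg => (key hg).2⟩

theorem univ_subset_add_E {S : Set B} (hS : G B ⊆ S) : Set.univ ⊆ S + E B := fun x _ =>
  ⟨x + 1, hS (add_one_mem_G x), lam x 1, lam_mem_E x one_mem_E, by
    change x + 1 + lam x 1 = x
    rw [add_add_one_add, add_lam_one]⟩

theorem socleSeries_zero_add_E : socleSeries B 0 + E B = E B := by
  change ({1} : Set B) + E B = E B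
  ext x
  simp [Set.singleton_add, one_add']

/-! ### Right nilpotency -/

/-- Elements of `Soc_{k+1}(B)` act trivially modulo `Soc_k(B)`. -/
theorem dot_mem_socleSeries {k : ℕ} {s : B} (hs : s ∈ socleSeries B (k + 1)) (b : B) :
    dot s b ∈ socleSeries B k := by
  have h := socleSeries_isIdeal (B := B) k
  rw [← h.proj_eq_one, h.proj_dot, dot_eq, socle_lam (mem_socleSeries_succ.1 hs), add_opp]

theorem dotAddE_univ_subset (hE : IsIdeal (E B)) {X : Set B} {k : ℕ}
    (hX : X ⊆ socleSeries B (k + 1) + E B) : dotAddE X Set.univ ⊆ socleSeries B k + E B := by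
  have h := socleSeries_isIdeal (B := B) k
  refine dotAddE_subset h.one_mem h.add_mem (fun _ => h.opp_mem) fun x hx b _ => ?_
  obtain ⟨s, hs, e, he, rfl⟩ := hX hx
  change dot (s + e) b ∈ _
  rw [dot_add_E_left hE (socleSeries_subset_G _ hs) he]
  exact dot_mem_socleSeries hs b

theorem isRightNilpotent_of_isNilpotent (hB : IsNilpotent B) (hE : IsIdeal (E B)) :
    IsRightNilpotent B := by
  obtain ⟨n, hn, -⟩ := hB.exists_G_subset
  have key : ∀ j k, j + k = n → rightSeries B j ⊆ socleSeries B k + E B := by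
    intro j
    induction j with
    | zero =>
      rintro k hk
      obtain rfl : k = n := by omega
      exact univ_subset_add_E hn
    | succ j ih => exact fun k hk => dotAddE_univ_subset hE (ih (k + 1) (by omega))
  have h0 := key n 0 rfl
  rw [socleSeries_zero_add_E] at h0
  refine ⟨n, subset_antisymm h0 ?_⟩
  rcases n with - | m
  · exact Set.subset_univ _
  · exact E_subset_dotAddE _ _

/-! ### Left nilpotency -/

theorem opp_eq_inv_of_mem_socle {s : B} (hs : s ∈ socle B) : opp s = s⁻¹ := by
  rw [opp, socle_lam hs]

/-- Conjugation by `b` in `(B, ∘)` restricts to `λ_b` on the socle, up to an idempotent. Hence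
`b · s` is a commutator. -/
theorem dot_socle_eq_commutator {s : B} (hs : s ∈ socle B) (b : B) :
    dot b s = b * s * b⁻¹ * s⁻¹ := by
  have hy := socle_conj_mem hs b
  have h1 : b * s * b⁻¹ = lam b s + 1 := by
    apply add_left_cancel (a := b)
    -- compare `b + y = y + b + 1` with `y + b = y ∘ b = b ∘ s`, where `y = b ∘ s ∘ b⁻`
    rw [socle_comm hy, ← socle_mul_eq hy, inv_mul_cancel_right, mul_eq_add_lam, add_assoc]
  rw [dot_eq, socle_mul_eq hy, h1, add_add_one_add, opp_eq_inv_of_mem_socle hs]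

variable (B) in
/-- `Soc(B) ∩ ζ_i(B)`. -/
def socleCenter (i : ℕ) : Set B := socle B ∩ (Subgroup.upperCentralSeries B i : Set B)

theorem add_mem_socleCenter {i : ℕ} {x y : B} (hx : x ∈ socleCenter B i)
    (hy : y ∈ socleCenter B i) : x + y ∈ socleCenter B i := by
  rw [← socle_mul_eq hx.1]
  exact ⟨socle_mul_mem hx.1 hy.1, mul_mem hx.2 hy.2⟩

theorem opp_mem_socleCenter {i : ℕ} {x : B} (hx : x ∈ socleCenter B i) :
    opp x ∈ socleCenter B i := by
  rw [opp_eq_inv_of_mem_socle hx.1]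
  exact ⟨socle_inv_mem hx.1, inv_mem hx.2⟩

theorem dot_mem_socleCenter {i : ℕ} {s : B} (hs : s ∈ socleCenter B (i + 1)) (b : B) :
    dot b s ∈ socleCenter B i := by
  rw [dot_socle_eq_commutator hs.1]
  refine ⟨socle_mul_mem (socle_conj_mem hs.1 b) (socle_inv_mem hs.1), ?_⟩
  have h := inv_mem (Subgroup.mem_upperCentralSeries_succ_iff.1 hs.2 b)
  rwa [commutatorElement_inv, commutatorElement_def] at h

theorem dotAddE_univ_left_subset {I : Set B} (h : IsIdeal I) {X : Set B} {i : ℕ}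
    (hX : X ⊆ h.proj ⁻¹' socleCenter h.Quo (i + 1) + E B) :
    dotAddE Set.univ X ⊆ h.proj ⁻¹' socleCenter h.Quo i + E B := by
  refine dotAddE_subset ⟨one_mem_socle, one_mem _⟩ (fun _ hx _ hy => add_mem_socleCenter hx hy)
    (fun _ hx => opp_mem_socleCenter hx) fun b _ x hx => ?_
  obtain ⟨s, hs, e, he, rfl⟩ := hX hx
  change dot b (s + e) ∈ _
  rw [dot_add_E_right b s he]
  exact dot_mem_socleCenter hs (h.proj b)

/-- If `G ⊆ ζ_n(B)`, then `n` steps of the left series lead from `Soc_{k+1}(B) + E` into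
`Soc_k(B) + E`. -/
theorem leftSeries_add_subset {n m k : ℕ}
    (hn : G B ⊆ (Subgroup.upperCentralSeries B n : Set B))
    (hm : leftSeries B m ⊆ socleSeries B (k + 1) + E B) :
    leftSeries B (m + n) ⊆ socleSeries B k + E B := by
  have h := socleSeries_isIdeal (B := B) k
  have hproj : ∀ g ∈ G B, h.proj g ∈ Subgroup.upperCentralSeries h.Quo n := fun g hg =>
    Subgroup.upperCentralSeries.map (f := (⟨⟨h.proj, rfl⟩, h.proj_mul⟩ : B →* h.Quo))
      h.proj_surjective n ⟨g, hn hg, rfl⟩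
  have key : ∀ j i, j + i = n →
      leftSeries B (m + j) ⊆ h.proj ⁻¹' socleCenter h.Quo i + E B := by
    intro j
    induction j with
    | zero =>
      intro i hi
      obtain rfl : i = n := by omega
      exact hm.trans (Set.add_subset_add_right fun s hs =>
        ⟨mem_socleSeries_succ.1 hs, hproj s (socleSeries_subset_G _ hs)⟩)
    | succ j ih => exact fun i hi => dotAddE_univ_left_subset h (ih (i + 1) (by omega))
  refine (key n 0 rfl).trans (Set.add_subset_add_right fun s hs => ?_)
  have h0 : h.proj s ∈ Subgroup.upperCentralSeries h.Quo 0 := hs.2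
  rw [Subgroup.upperCentralSeries_zero, Subgroup.mem_bot] at h0
  exact h.proj_eq_one.1 h0

theorem isLeftNilpotent_of_isNilpotent (hB : IsNilpotent B) : IsLeftNilpotent B := by
  obtain ⟨n, hn, hn'⟩ := hB.exists_G_subset
  have key : ∀ j k, j + k = n → leftSeries B (j * n) ⊆ socleSeries B k + E B := by
    intro j
    induction j with
    | zero =>
      rintro k hk
      obtain rfl : k = n := by omega
      rw [zero_mul]
      exact univ_subset_add_E hn
    | succ j ih =>
      intro k hk
      rw [Nat.succ_mul]
      exact leftSeries_add_subset hn' (ih (k + 1) (by omega))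
  have h0 := key n 0 rfl
  rw [socleSeries_zero_add_E] at h0
  refine ⟨n * n, subset_antisymm h0 ?_⟩
  rcases n * n with - | m
  · exact Set.subset_univ _
  · exact E_subset_dotAddE _ _

end Nilpotency

end LeftSemiBrace

theorem mainTheorem2 (B : Type u) [LeftSemiBrace B]
    (hB : LeftSemiBrace.IsNilpotent B)
    (hE : LeftSemiBrace.IsIdeal (LeftSemiBrace.E B)) :
    LeftSemiBrace.IsRightNilpotent B ∧
      (Finite (LeftSemiBrace.G B) → AddGroup.IsNilpotent (LeftSemiBrace.G B) →
        LeftSemiBrace.IsLeftNilpotent B) :=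
  ⟨LeftSemiBrace.isRightNilpotent_of_isNilpotent hB hE,
    fun _ _ => LeftSemiBrace.isLeftNilpotent_of_isNilpotent hB⟩
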